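/- Let $N\ge 0$ and let $\lambda_1,\dots,\lambda_N$ be pairwise distinct complex numbers with $\operatorname{Im}\lambda_n>0$. For constants $c_1,\dots,c_N\in\mathbb C$ and $(x,t)\in\mathbb R^2$ put $\theta(z;x,t)=zx+z^2t$ and consider the following reflectionless Riemann–Hilbert problem for the focusing NLS equation $i\psi_t=-\tfrac12\psi_{xx}-|\psi|^2\psi$: find a $2\times2$ matrix function $M(z)=M(z;x,t)$, analytic in $\mathbb C\setminus\{\lambda_n,\overline{\lambda_n}\}_{n=1}^N$, with at most simple poles at these points, such that $$\operatorname*{Res}_{z=\lambda_n}M(z)=\lim_{z\to\lambda_n}M(z)\begin{pmatrix}0&0\\ c_ne^{2i\theta(\lambda_n;x,t)}&0\end{pmatrix},\qquad \operatorname*{Res}_{z=\overline{\lambda_n}}M(z)=\lim_{z\to\overline{\lambda_n}}M(z)\begin{pmatrix}0&-\overline{c_n}e^{-2i\theta(\overline{\lambda_n};x,t)}\\ 0&0\end{pmatrix}$$ for all $n$, and $M(z)=I+O(z^{-1})$ as $z\to\infty$. A function $\psi:\mathbb R^2\to\mathbb C$ is called an $N$-soliton solution with eigenvalues $\{\lambda_n\}$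 and normalization constants $\{c_n\}$ if for every $(x,t)$ this problem has a solution with $M_{12}(z)=\dfrac{\psi(x,t)}{2iz}+O(z^{-2})$ as $z\to\infty$. Let $$c_n=\prod_{\ell=1}^N(\lambda_n-\overline{\lambda_\ell})\prod_{\substack{\ell=1\\ \ell\ne n}}^N\frac1{\lambda_n-\lambda_\ell},\qquad n=1,\dots,N.$$ Then there is exactly one $N$-soliton solution $\psi_N$ with eigenvalues $\{\lambda_n\}$ and these normalization constants. It is extremal, with its maximal amplitude at the origin: for every choice of nonzero constants $c_1',\dots,c_N'$, every $N$-soliton solution $\psi$ with eigenvalues $\{\lambda_n\}$ and normalization constants $\{c_n'\}$, and every $(x,t)\in\mathbb R^2$, one has $|\psi(x,t)|\le|\psi_N(0,0)|$. Moreover $$|\psi_N(0,0)|=2\operatorname{Im}\Big(\sum_{n=1}^N\lambda_n\Big).$$ -/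

import Mathlib

open Filter Topology Asymptotics Bornology
open scoped ComplexConjugate

/-- The phase `θ(z; x, t) = z x + z² t`. -/
noncomputable def phase (z : ℂ) (x t : ℝ) : ℂ := z * x + z ^ 2 * t

/-- `M` solves, at the point `(x, t)`, the reflectionless (`r ≡ 0`) Riemann-Hilbert problem of the
focusing nonlinear Schrödinger equation with simple eigenvalues `lam n` in the upper half plane and
normalization constants `c n`. Because there is no jump on the real line, `M` is analytic away from
the points `lam n`, `conj (lam n)`. At such a point `p` the pole is at most simple, with residue
`R = lim (z - p) M(z)`, and the residue condition is `R = lim M(z) V` for the nilpotent matrix `V`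
written below. The values of `M` at the poles themselves are irrelevant. -/
structure IsRHPSolution {N : ℕ} (lam c : Fin N → ℂ) (x t : ℝ)
    (M : ℂ → Matrix (Fin 2) (Fin 2) ℂ) : Prop where
  analytic : ∀ i j, DifferentiableOn ℂ (fun z => M z i j)
    {z | ∀ n, z ≠ lam n ∧ z ≠ conj (lam n)}
  residue_upper : ∀ n, ∃ R : Matrix (Fin 2) (Fin 2) ℂ,
    Tendsto (fun z => (z - lam n) • M z) (𝓝[≠] (lam n)) (𝓝 R) ∧
    Tendsto (fun z => M z *
        !![0, 0; c n * Complex.exp (2 * Complex.I * phase (lam n) x t), 0])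
      (𝓝[≠] (lam n)) (𝓝 R)
  residue_lower : ∀ n, ∃ R : Matrix (Fin 2) (Fin 2) ℂ,
    Tendsto (fun z => (z - conj (lam n)) • M z) (𝓝[≠] (conj (lam n))) (𝓝 R) ∧
    Tendsto (fun z => M z *
        !![0, -conj (c n) * Complex.exp (-2 * Complex.I * phase (conj (lam n)) x t); 0, 0])
      (𝓝[≠] (conj (lam n))) (𝓝 R)
  normalization : ∀ i j, (fun z => M z i j - (1 : Matrix (Fin 2) (Fin 2) ℂ) i j)
    =O[cobounded ℂ] (fun z => z⁻¹)

/-- `ψ` is the `N`-soliton solution with eigenvalues `lam` and normalization constants `c`: for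
every `(x, t)` the value `ψ x t` is read off from a solution `M` of the Riemann-Hilbert problem
through the expansion `M₁₂(z) = ψ(x, t) / (2 i z) + O(z⁻²)` as `z → ∞`. -/
def IsNSoliton {N : ℕ} (lam c : Fin N → ℂ) (ψ : ℝ → ℝ → ℂ) : Prop :=
  ∀ x t : ℝ, ∃ M : ℂ → Matrix (Fin 2) (Fin 2) ℂ, IsRHPSolution lam c x t M ∧
    (fun z => M z 0 1 - ψ x t / (2 * Complex.I * z)) =O[cobounded ℂ] (fun z => (z ^ 2)⁻¹)

/-- All amplitudes `|ψ(x, t)|`, over all `(x, t)` and all `N`-soliton solutions `ψ` with the given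
eigenvalues (the nonzero normalization constants being arbitrary). -/
def solitonAmplitudes {N : ℕ} (lam : Fin N → ℂ) : Set ℝ :=
  {A | ∃ (c : Fin N → ℂ) (ψ : ℝ → ℝ → ℂ) (x t : ℝ),
    (∀ n, c n ≠ 0) ∧ IsNSoliton lam c ψ ∧ A = ‖ψ x t‖}

/-- `ψ` attains at `(x, t)` the maximal amplitude possible for an `N`-soliton solution with
eigenvalues `lam`. -/
def IsExtremalAt {N : ℕ} (lam : Fin N → ℂ) (ψ : ℝ → ℝ → ℂ) (x t : ℝ) : Prop :=
  IsGreatest (solitonAmplitudes lam) ‖ψ x t‖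

/-- The normalization constants `c_n = ∏_ℓ (λ_n - conj λ_ℓ) ∏_{ℓ ≠ n} (λ_n - λ_ℓ)⁻¹`. -/
noncomputable def extremalConst {N : ℕ} (lam : Fin N → ℂ) (n : Fin N) : ℂ :=
  (∏ l, (lam n - conj (lam l))) * ∏ l ∈ Finset.univ.erase n, (lam n - lam l)⁻¹

/-! Only the first row $(f,g)=(M_{11},M_{12})$ matters. By Liouville $f=1+\sum a_n/(z-\lambda_n)$
and $g=\sum b_n/(z-\overline{\lambda_n})$, and the residue conditions become a linear system for
$(a,b)$, with $\psi=2i\sum b_n$. Write $F^*(z)=\overline{F(\bar z)}$. The residues of $ff^*+gg^*$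
cancel, so it is constant (`SolvesResidueSystem.det_eq`), and $|f|^2+|g|^2=1$ on the real line. For
the homogeneous system the constant is $0$, which forces $a=b=0$; hence the square system is
uniquely solvable, and $\psi$ exists and is unique.

Bound: let $B=\prod(z-\overline{\lambda_n})/(z-\lambda_n)$, which is unimodular on the real line and
whose zeros cancel the poles of $f^*$ and $g$. Take $|\omega|=1$ with $\omega\sum b_n=-i|\sum b_n|$
and put $H=\frac12(f+f^*B+\omega gB-(\omega g)^*)$. It is analytic on the closed lower half plane
and $|H|\le1$ on the real line (`norm_half_sum_le_one`). Phragmén–Lindelöf then makes the imaginary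
part of its $1/z$ coefficient nonnegative (`im_nonneg_of_norm_le_one`). That imaginary part is
$\operatorname{Im}\sum\lambda_n-|\sum b_n|$, whence `SolvesResidueSystem.norm_sum_le`.

Equality: the given $c_n$ are the residues of $B$ at $\lambda_n$. At the origin the exponentials are
$1$, so the residue conditions say $gB=f-1$ and $f/B=1-g$. Therefore $2gB=B-1$, and the $1/z$
coefficients give $\sum b_n=i\operatorname{Im}\sum\lambda_n$. -/

/-! ### Liouville's theorem with removable singularities -/

/-- A function with removable singularities on a finite set which vanishes at infinity is zero. -/
theorem eq_zero_of_removable_of_tendsto_zero (S : Finset ℂ) : ∀ F : ℂ → ℂ,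
    DifferentiableOn ℂ F (↑S)ᶜ →
    (∀ p ∈ S, Tendsto (fun z => (z - p) * F z) (𝓝[≠] p) (𝓝 0)) →
    Tendsto F (cobounded ℂ) (𝓝 0) → ∀ z ∉ S, F z = 0 := by
  induction S using Finset.induction_on with
  | empty =>
    intro F hd _ h0 z _
    have hd' : Differentiable ℂ F := by simpa [differentiableOn_univ] using hd
    rw [Metric.cobounded_eq_cocompact] at h0
    exact hd'.apply_eq_of_tendsto_cocompact z h0
  | insert p S hp ih =>
    intro F hd hr h0 z hz
    have hopen : IsOpen ((↑S : Set ℂ)ᶜ) := S.finite_toSet.isClosed.isOpen_compl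
    -- Filling in the singularity at `p` by the limit leaves a function with exceptional set `S`, to
    -- which the induction hypothesis applies.
    set G := Function.update F p (limUnder (𝓝[≠] p) F) with hG
    have hGF : ∀ w, w ≠ p → G w = F w := fun w hw => by simp [hG, hw]
    have hdG : DifferentiableOn ℂ G (↑S)ᶜ := by
      refine Complex.differentiableOn_update_limUnder_of_isLittleO
        (hopen.mem_nhds (by simpa using hp)) (hd.mono ?_) ?_
      · rintro w ⟨h1, h2⟩
        simp_all
      · rw [isLittleO_iff_tendsto']
        · have h1 := hr p (Finset.mem_insert_self _ _)
          have h2 : Tendsto (fun z : ℂ => (z - p) * F p) (𝓝[≠] p) (𝓝 0) := by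
            have : ContinuousAt (fun z : ℂ => (z - p) * F p) p := by fun_prop
            simpa using this.tendsto.mono_left nhdsWithin_le_nhds
          have h3 := h1.sub h2
          simp only [sub_zero] at h3
          refine h3.congr fun w => ?_
          rw [div_inv_eq_mul]; ring
        · filter_upwards [self_mem_nhdsWithin] with w hw h
          exact absurd (inv_eq_zero.mp h) (sub_ne_zero.mpr hw)
    have hrG : ∀ q ∈ S, Tendsto (fun z => (z - q) * G z) (𝓝[≠] q) (𝓝 0) := by
      intro q hq
      have hqp : q ≠ p := fun h => hp (h ▸ hq)
      refine (hr q (Finset.mem_insert_of_mem hq)).congr' ?_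
      filter_upwards [nhdsWithin_le_nhds (isOpen_ne.mem_nhds hqp)] with w hw
      rw [hGF w hw]
    have h0G : Tendsto G (cobounded ℂ) (𝓝 0) := by
      refine h0.congr' ?_
      have : ∀ᶠ w in cobounded ℂ, w ≠ p := by
        rw [Metric.cobounded_eq_cocompact]
        exact (isCompact_singleton (x := p)).compl_mem_cocompact
      filter_upwards [this] with w hw
      rw [hGF w hw]
    simp only [Finset.mem_insert, not_or] at hz
    rw [← hGF z hz.1]
    exact ih G hdG hrG h0G z hz.2

/-! ### Partial fractions: residues and behaviour at infinity -/

/-- The partial fraction `∑ a_n / (z - p_n)`. -/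
noncomputable def partialFrac {ι : Type*} [Fintype ι] (p a : ι → ℂ) (z : ℂ) : ℂ :=
  ∑ n, a n / (z - p n)

section PartialFrac
variable {ι : Type*} [Fintype ι]

theorem partialFrac_differentiableAt {p : ι → ℂ} (a : ι → ℂ) {z : ℂ} (h : ∀ n, z ≠ p n) :
    DifferentiableAt ℂ (partialFrac p a) z := by
  unfold partialFrac
  refine DifferentiableAt.fun_sum fun n _ => ?_
  exact (differentiableAt_const _).div (by fun_prop) (sub_ne_zero.mpr (h n))

theorem partialFrac_residue {p : ι → ℂ} (hp : Function.Injective p) (a : ι → ℂ) (n : ι) :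
    Tendsto (fun z => (z - p n) * partialFrac p a z) (𝓝[≠] (p n)) (𝓝 (a n)) := by
  classical
  have key : Tendsto (fun z => a n + (z - p n) * ∑ m ∈ Finset.univ.erase n, a m / (z - p m))
      (𝓝[≠] (p n)) (𝓝 (a n)) := by
    have : ContinuousAt
        (fun z => a n + (z - p n) * ∑ m ∈ Finset.univ.erase n, a m / (z - p m)) (p n) := by
      refine continuousAt_const.add ((by fun_prop : ContinuousAt (fun z => z - p n) _).mul ?_)
      refine tendsto_finsetSum _ fun m hm => ?_
      refine ContinuousAt.div continuousAt_const (by fun_prop) ?_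
      exact sub_ne_zero.mpr fun h => (Finset.ne_of_mem_erase hm) (hp h).symm
    simpa using this.tendsto.mono_left nhdsWithin_le_nhds
  refine key.congr' ?_
  filter_upwards [self_mem_nhdsWithin] with z hz
  have hz' : z - p n ≠ 0 := sub_ne_zero.mpr hz
  rw [partialFrac, ← Finset.add_sum_erase _ _ (Finset.mem_univ n), mul_add]
  field_simp

theorem tendsto_div_sub_cobounded (q p : ℂ) :
    Tendsto (fun z : ℂ => z * (q / (z - p))) (cobounded ℂ) (𝓝 q) := by
  have h1 : Tendsto (fun z : ℂ => (z - p)⁻¹) (cobounded ℂ) (𝓝 0) :=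
    tendsto_inv₀_cobounded.comp (tendsto_sub_const_cobounded p)
  have h2 := (h1.const_mul (p * q)).const_add q
  simp only [mul_zero, add_zero] at h2
  refine h2.congr' ?_
  have : ∀ᶠ w in cobounded ℂ, w ≠ p := by
    rw [Metric.cobounded_eq_cocompact]
    exact (isCompact_singleton (x := p)).compl_mem_cocompact
  filter_upwards [this] with z hz
  have hz' : z - p ≠ 0 := sub_ne_zero.mpr hz
  field_simp
  ring

theorem partialFrac_tendsto_mul (p a : ι → ℂ) :
    Tendsto (fun z => z * partialFrac p a z) (cobounded ℂ) (𝓝 (∑ n, a n)) := by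
  simp only [partialFrac, Finset.mul_sum]
  exact tendsto_finsetSum _ fun n _ => tendsto_div_sub_cobounded _ _

theorem eventually_ne_zero_cobounded : ∀ᶠ z : ℂ in cobounded ℂ, z ≠ 0 := by
  rw [Metric.cobounded_eq_cocompact]
  exact (isCompact_singleton (x := (0 : ℂ))).compl_mem_cocompact

theorem isBigO_inv_of_tendsto_mul {F : ℂ → ℂ} {l : ℂ}
    (h : Tendsto (fun z => z * F z) (cobounded ℂ) (𝓝 l)) :
    F =O[cobounded ℂ] fun z => z⁻¹ := by
  have h1 := (h.isBigO_one ℂ).mul (isBigO_refl (fun z : ℂ => z⁻¹) (cobounded ℂ))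
  simp only [one_mul] at h1
  refine h1.congr' ?_ EventuallyEq.rfl
  filter_upwards [eventually_ne_zero_cobounded] with z hz
  field_simp

theorem tendsto_zero_of_isBigO_inv {F : ℂ → ℂ} (h : F =O[cobounded ℂ] fun z => z⁻¹) :
    Tendsto F (cobounded ℂ) (𝓝 0) :=
  h.trans_tendsto tendsto_inv₀_cobounded

theorem partialFrac_tendsto_zero (p a : ι → ℂ) :
    Tendsto (partialFrac p a) (cobounded ℂ) (𝓝 0) :=
  tendsto_zero_of_isBigO_inv (isBigO_inv_of_tendsto_mul (partialFrac_tendsto_mul p a))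

/-- Termwise $a/(z-p)-a/z=z^{-1}\cdot ap/(z-p)$, so the error is $z^{-1}$ times a partial fraction
with residues $a_np_n$. -/
theorem partialFrac_sub_isBigO (p a : ι → ℂ) :
    (fun z => partialFrac p a z - (∑ n, a n) / z) =O[cobounded ℂ] fun z => (z ^ 2)⁻¹ := by
  have h1 := isBigO_inv_of_tendsto_mul (partialFrac_tendsto_mul p fun n => a n * p n)
  have h2 := h1.mul (isBigO_refl (fun z : ℂ => z⁻¹) (cobounded ℂ))
  refine h2.congr' ?_ (Eventually.of_forall fun z => by
    change z⁻¹ * z⁻¹ = (z ^ 2)⁻¹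
    rw [sq, mul_inv])
  have : ∀ᶠ w in cobounded ℂ, ∀ n, w ≠ p n := by
    rw [Metric.cobounded_eq_cocompact]
    exact eventually_all.mpr fun n => (isCompact_singleton (x := p n)).compl_mem_cocompact
  filter_upwards [eventually_ne_zero_cobounded, this] with z hz hzn
  simp only [partialFrac, Finset.sum_mul, Finset.sum_div, ← Finset.sum_sub_distrib]
  refine Finset.sum_congr rfl fun n _ => ?_
  have := sub_ne_zero.mpr (hzn n)
  field_simp
  ring

theorem partialFrac_add (p a b : ι → ℂ) (z : ℂ) :
    partialFrac p (a + b) z = partialFrac p a z + partialFrac p b z := by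
  simp [partialFrac, add_div, Finset.sum_add_distrib]

theorem partialFrac_smul (p a : ι → ℂ) (c z : ℂ) :
    partialFrac p (c • a) z = c * partialFrac p a z := by
  simp [partialFrac, mul_div_assoc, Finset.mul_sum]

theorem conj_partialFrac (p a : ι → ℂ) (z : ℂ) :
    conj (partialFrac p a z) =
      partialFrac (fun n => conj (p n)) (fun n => conj (a n)) (conj z) := by
  simp [partialFrac]

/-- A function with at most simple poles at the points `p n`, the residues being `a n`, and with
limit zero at infinity equals its partial fraction. -/
theorem eq_partialFrac {p : ι → ℂ} (hp : Function.Injective p) {a : ι → ℂ}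
    {F : ℂ → ℂ} {e : ℂ} (S : Finset ℂ) (hS : ∀ n, p n ∈ S) (hd : DifferentiableOn ℂ F (↑S)ᶜ)
    (hr : ∀ n, Tendsto (fun z => (z - p n) * F z) (𝓝[≠] (p n)) (𝓝 (a n)))
    (hr' : ∀ q ∈ S, (∀ n, q ≠ p n) → Tendsto (fun z => (z - q) * F z) (𝓝[≠] q) (𝓝 0))
    (h0 : Tendsto (fun z => F z - e) (cobounded ℂ) (𝓝 0)) {z : ℂ} (hz : z ∉ S) :
    F z = e + partialFrac p a z := by
  have hlin : ∀ q c : ℂ, Tendsto (fun z : ℂ => (z - q) * c) (𝓝[≠] q) (𝓝 0) := fun q c => by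
    have : ContinuousAt (fun z : ℂ => (z - q) * c) q := by fun_prop
    simpa using this.tendsto.mono_left nhdsWithin_le_nhds
  have := eq_zero_of_removable_of_tendsto_zero S (fun z => F z - e - partialFrac p a z) ?_ ?_ ?_ z hz
  · linear_combination this
  · refine (hd.sub (differentiableOn_const _)).sub fun w hw => ?_
    refine (partialFrac_differentiableAt a fun n h => hw ?_).differentiableWithinAt
    rw [h]; exact hS n
  · intro q hq
    by_cases hqp : ∃ n, q = p n
    · obtain ⟨n, rfl⟩ := hqp
      have := ((hr n).sub (hlin (p n) e)).sub (partialFrac_residue hp a n)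
      simp only [sub_zero, sub_self] at this
      exact this.congr fun w => by ring
    · push Not at hqp
      have hc : ContinuousAt (fun z => (z - q) * partialFrac p a z) q :=
        (by fun_prop : ContinuousAt (fun z => z - q) q).mul
          (partialFrac_differentiableAt a hqp).continuousAt
      have h2 := hc.tendsto.mono_left (nhdsWithin_le_nhds (s := {q}ᶜ))
      have := ((hr' q hq hqp).sub (hlin q e)).sub h2
      simp only [sub_self, zero_mul] at this
      exact this.congr fun w => by ring
  · simpa using h0.sub (partialFrac_tendsto_zero p a)

end PartialFrac

/-! ### The residue system: determinant relation and unique solvability -/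

/-- The linear system for the residues `a` of `M₁₁` and `b` of `M₁₂`, where `e` is the value of
`M₁₁` at infinity. -/
structure SolvesResidueSystem {N : ℕ} (lam γ : Fin N → ℂ) (e : ℂ) (a b : Fin N → ℂ) : Prop where
  upper : ∀ n, a n = γ n * partialFrac (fun m => conj (lam m)) b (lam n)
  lower : ∀ n, b n = -conj (γ n) * (e + partialFrac lam a (conj (lam n)))

/-- The poles `lam n` and `conj (lam n)`. -/
noncomputable def poleSet {N : ℕ} (lam : Fin N → ℂ) : Finset ℂ :=
  Finset.univ.image lam ∪ Finset.univ.image fun n => conj (lam n)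

section System
variable {N : ℕ} {lam : Fin N → ℂ}

theorem notMem_poleSet {z : ℂ} :
    z ∉ poleSet lam ↔ ∀ n, z ≠ lam n ∧ z ≠ conj (lam n) := by
  simp only [poleSet, Finset.mem_union, Finset.mem_image, Finset.mem_univ, true_and, not_or,
    not_exists]
  exact ⟨fun h n => ⟨fun h' => h.1 n h'.symm, fun h' => h.2 n h'.symm⟩,
    fun h => ⟨fun n h' => (h n).1 h'.symm, fun n h' => (h n).2 h'.symm⟩⟩

theorem coe_compl_poleSet :
    ((poleSet lam : Set ℂ))ᶜ = {z | ∀ n, z ≠ lam n ∧ z ≠ conj (lam n)} := by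
  ext z
  simp only [Set.mem_compl_iff, Finset.mem_coe, notMem_poleSet, Set.mem_ofPred_eq]

theorem injective_conj_comp (hlam : Function.Injective lam) :
    Function.Injective fun n => conj (lam n) :=
  (starRingEnd ℂ).injective.comp hlam

theorem ne_conj (him : ∀ n, 0 < (lam n).im) (n m : Fin N) : lam n ≠ conj (lam m) := fun h => by
  have h1 := congrArg Complex.im h
  simp only [Complex.conj_im] at h1
  linarith [him n, him m]

theorem ne_of_im_nonpos (him : ∀ n, 0 < (lam n).im) {z : ℂ} (hz : z.im ≤ 0) (n : Fin N) :
    z ≠ lam n := fun h => by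
  have := him n
  rw [← h] at this
  linarith

theorem ofReal_ne (him : ∀ n, 0 < (lam n).im) (x : ℝ) (n : Fin N) :
    (x : ℂ) ≠ lam n ∧ (x : ℂ) ≠ conj (lam n) := by
  refine ⟨ne_of_im_nonpos him (by simp) n, fun h => ?_⟩
  have h1 := congrArg Complex.im h
  have := him n
  simp at h1
  linarith

variable {γ : Fin N → ℂ} {e : ℂ} {a b : Fin N → ℂ}

/-- The determinant relation `M₁₁ M₁₁* + M₁₂ M₁₂* = |e|²`, where `F*(z) = conj (F (conj z))`. -/
theorem SolvesResidueSystem.det_eq (hlam : Function.Injective lam) (him : ∀ n, 0 < (lam n).im)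
    (h : SolvesResidueSystem lam γ e a b) {z : ℂ} (hz : z ∉ poleSet lam) :
    (e + partialFrac lam a z) *
        (conj e + partialFrac (fun m => conj (lam m)) (fun m => conj (a m)) z) +
      partialFrac (fun m => conj (lam m)) b z * partialFrac lam (fun m => conj (b m)) z =
      e * conj e := by
  have hinj' := injective_conj_comp hlam
  have hne : ∀ n m, conj (lam n) ≠ lam m := fun n m => (ne_conj him m n).symm
  set f : ℂ → ℂ := fun z => e + partialFrac lam a z with hf
  set fs : ℂ → ℂ := fun z =>
    conj e + partialFrac (fun m => conj (lam m)) (fun m => conj (a m)) z with hfs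
  set g : ℂ → ℂ := partialFrac (fun m => conj (lam m)) b with hg
  set gs : ℂ → ℂ := partialFrac lam (fun m => conj (b m)) with hgs
  have hlin : ∀ q c : ℂ, Tendsto (fun z : ℂ => (z - q) * c) (𝓝[≠] q) (𝓝 0) := fun q c => by
    have : ContinuousAt (fun z : ℂ => (z - q) * c) q := by fun_prop
    simpa using this.tendsto.mono_left nhdsWithin_le_nhds
  have ha : ∀ n, conj (a n) = conj (γ n) * gs (conj (lam n)) := fun n => by
    rw [h.upper n, map_mul, conj_partialFrac]
    simp [hgs]
  have hb : ∀ n, conj (b n) = -γ n * fs (lam n) := fun n => by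
    rw [h.lower n, map_mul, map_add, conj_partialFrac]
    simp [hfs]
  have key := eq_zero_of_removable_of_tendsto_zero (poleSet lam)
    (fun z => f z * fs z + g z * gs z - e * conj e) ?_ ?_ ?_ z hz
  · exact sub_eq_zero.mp key
  · intro w hw
    rw [coe_compl_poleSet] at hw
    have h1 := partialFrac_differentiableAt a fun n => (hw n).1
    have h2 := partialFrac_differentiableAt (fun m => conj (a m)) fun n => (hw n).2
    have h3 := partialFrac_differentiableAt b fun n => (hw n).2
    have h4 := partialFrac_differentiableAt (fun m => conj (b m)) fun n => (hw n).1
    exact (((h1.const_add e).mul (h2.const_add _)).add (h3.mul h4)).sub_const _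
      |>.differentiableWithinAt
  · intro p hp
    simp only [poleSet, Finset.mem_union, Finset.mem_image, Finset.mem_univ, true_and] at hp
    rcases hp with ⟨n, rfl⟩ | ⟨n, rfl⟩
    · have h1 := (hlin (lam n) e).add (partialFrac_residue hlam a n)
      have h2 : Tendsto fs (𝓝[≠] (lam n)) (𝓝 (fs (lam n))) :=
        ((partialFrac_differentiableAt _ fun m => ne_conj him n m).const_add
          _).continuousAt.tendsto.mono_left nhdsWithin_le_nhds
      have h3 : Tendsto g (𝓝[≠] (lam n)) (𝓝 (g (lam n))) :=
        (partialFrac_differentiableAt _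
          fun m => ne_conj him n m).continuousAt.tendsto.mono_left nhdsWithin_le_nhds
      have h4 := partialFrac_residue hlam (fun m => conj (b m)) n
      have h5 := ((h1.mul h2).add (h3.mul h4)).sub (hlin (lam n) (e * conj e))
      -- The residue at $\lambda_n$ vanishes: $a_n=\gamma_n g(\lambda_n)$ and
      -- $\overline{b_n}=-\gamma_n f^*(\lambda_n)$, so the two contributions are opposite.
      have h6 : (0 + a n) * fs (lam n) + g (lam n) * conj (b n) - 0 = 0 := by
        rw [hb, h.upper n]; ring
      rw [h6] at h5
      exact h5.congr fun w => by simp only [hf, hgs]; ring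
    · have h1 := (hlin (conj (lam n)) (conj e)).add
        (partialFrac_residue hinj' (fun m => conj (a m)) n)
      have h2 : Tendsto f (𝓝[≠] (conj (lam n))) (𝓝 (f (conj (lam n)))) :=
        ((partialFrac_differentiableAt _ fun m => hne n m).const_add
          _).continuousAt.tendsto.mono_left nhdsWithin_le_nhds
      have h3 : Tendsto gs (𝓝[≠] (conj (lam n))) (𝓝 (gs (conj (lam n)))) :=
        (partialFrac_differentiableAt _
          fun m => hne n m).continuousAt.tendsto.mono_left nhdsWithin_le_nhds
      have h4 := partialFrac_residue hinj' b n
      have h5 := ((h1.mul h2).add (h3.mul h4)).sub (hlin (conj (lam n)) (e * conj e))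
      have h6 : (0 + conj (a n)) * f (conj (lam n)) + gs (conj (lam n)) * b n - 0 = 0 := by
        rw [ha, h.lower n]; ring
      rw [h6] at h5
      exact h5.congr fun w => by simp only [hfs, hg]; ring
  · have h1 := (partialFrac_tendsto_zero lam a).const_add e
    have h2 := (partialFrac_tendsto_zero (fun m => conj (lam m)) (fun m => conj (a m))).const_add
      (conj e)
    have h3 := (partialFrac_tendsto_zero (fun m => conj (lam m)) b).mul
      (partialFrac_tendsto_zero lam (fun m => conj (b m)))
    simpa using ((h1.mul h2).add h3).sub_const (e * conj e)

theorem SolvesResidueSystem.norm_sq_eq (hlam : Function.Injective lam)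
    (him : ∀ n, 0 < (lam n).im) (h : SolvesResidueSystem lam γ e a b) (x : ℝ) :
    ‖e + partialFrac lam a x‖ ^ 2 + ‖partialFrac (fun m => conj (lam m)) b x‖ ^ 2 = ‖e‖ ^ 2 := by
  have h1 := h.det_eq hlam him (notMem_poleSet.mpr (ofReal_ne him x))
  have h2 := conj_partialFrac lam a x
  have h3 := conj_partialFrac (fun m => conj (lam m)) b x
  simp only [Complex.conj_ofReal, Complex.conj_conj] at h2 h3
  rw [← h2, ← h3, ← map_add, Complex.mul_conj, Complex.mul_conj, Complex.mul_conj] at h1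
  simp only [Complex.normSq_eq_norm_sq] at h1
  exact_mod_cast h1

/-- A partial fraction which vanishes on the real line has vanishing coefficients. -/
theorem eq_zero_of_partialFrac_ofReal_eq_zero {p : Fin N → ℂ} (hp : Function.Injective p)
    (him : ∀ n, (p n).im ≠ 0) (h : ∀ x : ℝ, partialFrac p a x = 0) : a = 0 := by
  set U : Set ℂ := (Set.range p)ᶜ with hU
  have hUo : IsOpen U := (Set.finite_range p).isClosed.isOpen_compl
  have hd : DifferentiableOn ℂ (partialFrac p a) U := fun w hw =>
    (partialFrac_differentiableAt a fun n h => hw ⟨n, h.symm⟩).differentiableWithinAt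
  have hc : IsPreconnected U :=
    ((Set.finite_range p).countable.isPathConnected_compl_of_one_lt_rank
      (by rw [Complex.rank_real_complex]; norm_num)).isConnected.isPreconnected
  have h0 : (0 : ℂ) ∈ U := by
    rintro ⟨n, hn⟩
    exact him n (by rw [hn]; simp)
  have hz : Set.EqOn (partialFrac p a) 0 U := by
    -- The complement of finitely many points is connected, and the real zeros accumulate at $0$,
    -- which is not a pole; so the identity theorem applies, and the coefficients are then recovered
    -- as residues of the zero function.
    refine (hd.analyticOnNhd hUo).eqOn_zero_of_preconnected_of_frequently_eq_zero hc h0 ?_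
    have ht : Tendsto (fun x : ℝ => (x : ℂ)) (𝓝[≠] (0 : ℝ)) (𝓝[≠] (0 : ℂ)) := by
      refine tendsto_nhdsWithin_iff.mpr ⟨?_, ?_⟩
      · simpa using Complex.continuous_ofReal.continuousAt.tendsto.mono_left
          (nhdsWithin_le_nhds (a := (0 : ℝ)) (s := {0}ᶜ))
      · filter_upwards [self_mem_nhdsWithin] with x hx
        simpa using hx
    exact ht.frequently (Eventually.frequently (Eventually.of_forall h))
  funext n
  refine tendsto_nhds_unique (partialFrac_residue hp a n) (tendsto_const_nhds.congr' ?_)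
  have hev : ∀ᶠ w in 𝓝[≠] (p n), w ∈ U := by
    have hfin : (Set.range p \ {p n}).Finite := (Set.finite_range p).sdiff
    have : (Set.range p \ {p n})ᶜ ∈ 𝓝 (p n) := hfin.isClosed.isOpen_compl.mem_nhds (by simp)
    filter_upwards [nhdsWithin_le_nhds this, self_mem_nhdsWithin] with w h1 h2 h3
    exact h1 ⟨h3, h2⟩
  filter_upwards [hev] with w hw
  rw [hz hw]; simp

/-- With $e=0$ the two squares in `norm_sq_eq` add up to zero, so both partial fractions vanish on
the real line. -/
theorem SolvesResidueSystem.eq_zero (hlam : Function.Injective lam) (him : ∀ n, 0 < (lam n).im)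
    (h : SolvesResidueSystem lam γ 0 a b) : a = 0 ∧ b = 0 := by
  have key := h.norm_sq_eq hlam him
  have h1 : ∀ x : ℝ, partialFrac lam a x = 0 := fun x => by
    have := key x
    rw [zero_add, norm_zero] at this
    rw [← norm_eq_zero]
    nlinarith [norm_nonneg (partialFrac lam a x),
      sq_nonneg ‖partialFrac (fun m => conj (lam m)) b x‖]
  have h2 : ∀ x : ℝ, partialFrac (fun m => conj (lam m)) b x = 0 := fun x => by
    have := key x
    rw [h1] at this
    simpa using this
  exact ⟨eq_zero_of_partialFrac_ofReal_eq_zero hlam (fun n => (him n).ne') h1,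
    eq_zero_of_partialFrac_ofReal_eq_zero (injective_conj_comp hlam)
      (fun n => by simpa using (him n).ne') h2⟩

theorem SolvesResidueSystem.unique (hlam : Function.Injective lam) (him : ∀ n, 0 < (lam n).im)
    {a' b' : Fin N → ℂ} (h : SolvesResidueSystem lam γ e a b)
    (h' : SolvesResidueSystem lam γ e a' b') : a = a' ∧ b = b' := by
  have : SolvesResidueSystem lam γ 0 (a + (-1 : ℂ) • a') (b + (-1 : ℂ) • b') := by
    constructor <;> intro n <;> rw [partialFrac_add, partialFrac_smul] <;>
      simp only [Pi.add_apply, Pi.smul_apply, smul_eq_mul]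
    · rw [h.upper n, h'.upper n]; ring
    · rw [h.lower n, h'.lower n]; ring
  obtain ⟨h1, h2⟩ := this.eq_zero hlam him
  simp only [neg_smul, one_smul, ← sub_eq_add_neg, sub_eq_zero] at h1 h2
  exact ⟨h1, h2⟩

/-- The system is linear with as many equations as unknowns, so triviality of the homogeneous
solutions gives existence. -/
theorem exists_solvesResidueSystem (hlam : Function.Injective lam) (him : ∀ n, 0 < (lam n).im)
    (γ : Fin N → ℂ) (e : ℂ) : ∃ a b, SolvesResidueSystem lam γ e a b := by
  let T : ((Fin N → ℂ) × (Fin N → ℂ)) →ₗ[ℂ] ((Fin N → ℂ) × (Fin N → ℂ)) :=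
    { toFun := fun v =>
        (fun n => v.1 n - γ n * partialFrac (fun m => conj (lam m)) v.2 (lam n),
         fun n => v.2 n + conj (γ n) * partialFrac lam v.1 (conj (lam n)))
      map_add' := fun v w => by
        ext n <;> simp only [Prod.fst_add, Prod.snd_add, Pi.add_apply, partialFrac_add] <;> ring
      map_smul' := fun c v => by
        ext n <;> simp only [Prod.smul_fst, Prod.smul_snd, Pi.smul_apply, smul_eq_mul,
          partialFrac_smul, RingHom.id_apply] <;> ring }
  have hT : ∀ v n, (T v).1 n = v.1 n - γ n * partialFrac (fun m => conj (lam m)) v.2 (lam n) ∧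
      (T v).2 n = v.2 n + conj (γ n) * partialFrac lam v.1 (conj (lam n)) :=
    fun v n => ⟨rfl, rfl⟩
  have hinj : Function.Injective T := by
    rw [injective_iff_map_eq_zero]
    intro v hv
    have hs : SolvesResidueSystem lam γ 0 v.1 v.2 := by
      constructor <;> intro n
      · have := (hT v n).1
        rw [hv] at this
        simp only [Prod.fst_zero, Pi.zero_apply] at this
        linear_combination -this
      · have := (hT v n).2
        rw [hv] at this
        simp only [Prod.snd_zero, Pi.zero_apply] at this
        linear_combination -this
    obtain ⟨h1, h2⟩ := hs.eq_zero hlam him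
    exact Prod.ext h1 h2
  obtain ⟨v, hv⟩ := (LinearMap.injective_iff_surjective.mp hinj) (0, fun n => -conj (γ n) * e)
  refine ⟨v.1, v.2, fun n => ?_, fun n => ?_⟩
  · have := (hT v n).1
    rw [hv] at this
    simp only [Pi.zero_apply] at this
    linear_combination -this
  · have := (hT v n).2
    rw [hv] at this
    linear_combination -this

end System

/-! ### Equivalence of the Riemann–Hilbert problem with the residue system -/

section RHP
variable {N : ℕ} {lam : Fin N → ℂ}

/-- The normalization constants `c n`, evolved to the point `(x, t)`. -/
noncomputable def evolvedConst (lam c : Fin N → ℂ) (x t : ℝ) (n : Fin N) : ℂ :=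
  c n * Complex.exp (2 * Complex.I * phase (lam n) x t)

theorem neg_conj_evolvedConst (lam c : Fin N → ℂ) (x t : ℝ) (n : Fin N) :
    -conj (c n) * Complex.exp (-2 * Complex.I * phase (conj (lam n)) x t) =
      -conj (evolvedConst lam c x t n) := by
  simp [evolvedConst, phase, ← Complex.exp_conj, map_ofNat]

theorem tendsto_cobounded_of_soliton_expansion {F : ℂ → ℂ} {s : ℂ}
    (h : (fun z => F z - s / (2 * Complex.I * z)) =O[cobounded ℂ] fun z => (z ^ 2)⁻¹) :
    Tendsto (fun z => z * F z) (cobounded ℂ) (𝓝 (s / (2 * Complex.I))) := by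
  have h1 := (isBigO_refl (fun z : ℂ => z) (cobounded ℂ)).mul h
  have h2 : Tendsto (fun z : ℂ => z * (z ^ 2)⁻¹) (cobounded ℂ) (𝓝 0) := by
    refine tendsto_inv₀_cobounded.congr' ?_
    filter_upwards [eventually_ne_zero_cobounded] with z hz
    field_simp
  have h3 := (h1.trans_tendsto h2).add_const (s / (2 * Complex.I))
  rw [zero_add] at h3
  refine h3.congr' ?_
  filter_upwards [eventually_ne_zero_cobounded] with z hz
  have := Complex.I_ne_zero
  field_simp
  ring

/-- The first row of a solution of the Riemann-Hilbert problem is given by a solution of the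
residue system. -/
theorem IsRHPSolution.exists_solvesResidueSystem (hlam : Function.Injective lam)
    (him : ∀ n, 0 < (lam n).im) {c : Fin N → ℂ} {x t : ℝ} {M : ℂ → Matrix (Fin 2) (Fin 2) ℂ}
    (h : IsRHPSolution lam c x t M) {s : ℂ}
    (hs : (fun z => M z 0 1 - s / (2 * Complex.I * z)) =O[cobounded ℂ] fun z => (z ^ 2)⁻¹) :
    ∃ a b, SolvesResidueSystem lam (evolvedConst lam c x t) 1 a b ∧
      s = 2 * Complex.I * ∑ n, b n := by
  have hinj' := injective_conj_comp hlam
  have hne : ∀ n m, conj (lam n) ≠ lam m := fun n m => (ne_conj him m n).symm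
  set γ := evolvedConst lam c x t with hγ
  have hentry : ∀ {F : ℂ → Matrix (Fin 2) (Fin 2) ℂ} {p : ℂ} {R : Matrix (Fin 2) (Fin 2) ℂ},
      Tendsto F (𝓝[≠] p) (𝓝 R) → ∀ i j, Tendsto (fun z => F z i j) (𝓝[≠] p) (𝓝 (R i j)) :=
    fun hF i j => ((continuous_id.matrix_elem i j).tendsto _).comp hF
  choose R hR1 hR2 using h.residue_upper
  choose R' hR'1 hR'2 using h.residue_lower
  simp only [neg_conj_evolvedConst, ← hγ] at hR'2
  have u1 : ∀ n, Tendsto (fun z => (z - lam n) * M z 0 0) (𝓝[≠] (lam n)) (𝓝 (R n 0 0)) :=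
    fun n => by simpa using hentry (hR1 n) 0 0
  have u2 : ∀ n, Tendsto (fun z => (z - lam n) * M z 0 1) (𝓝[≠] (lam n)) (𝓝 (R n 0 1)) :=
    fun n => by simpa using hentry (hR1 n) 0 1
  have u3 : ∀ n, Tendsto (fun z => M z 0 1 * γ n) (𝓝[≠] (lam n)) (𝓝 (R n 0 0)) :=
    fun n => by
      change Tendsto (fun z => M z 0 1 * (c n * Complex.exp (2 * Complex.I * phase (lam n) x t))) _ _
      simpa [Matrix.mul_apply, Fin.sum_univ_two] using hentry (hR2 n) 0 0
  -- The second column of the nilpotent matrix is zero, so $M_{12}$ has no pole at $\lambda_n$;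
  -- likewise `l4` removes the pole of $M_{11}$ at $\overline{\lambda_n}$.
  have u4 : ∀ n, R n 0 1 = 0 := fun n => by
    have : Tendsto (fun _ : ℂ => (0 : ℂ)) (𝓝[≠] (lam n)) (𝓝 (R n 0 1)) := by
      simpa [Matrix.mul_apply, Fin.sum_univ_two] using hentry (hR2 n) 0 1
    exact tendsto_nhds_unique this tendsto_const_nhds
  have l1 : ∀ n, Tendsto (fun z => (z - conj (lam n)) * M z 0 0) (𝓝[≠] (conj (lam n)))
      (𝓝 (R' n 0 0)) := fun n => by simpa using hentry (hR'1 n) 0 0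
  have l2 : ∀ n, Tendsto (fun z => (z - conj (lam n)) * M z 0 1) (𝓝[≠] (conj (lam n)))
      (𝓝 (R' n 0 1)) := fun n => by simpa using hentry (hR'1 n) 0 1
  have l3 : ∀ n, Tendsto (fun z => M z 0 0 * -conj (γ n)) (𝓝[≠] (conj (lam n)))
      (𝓝 (R' n 0 1)) := fun n => by
    simpa only [Matrix.mul_apply, Fin.sum_univ_two, Matrix.of_apply, Matrix.cons_val_zero,
      Matrix.cons_val_one, Matrix.cons_val', Matrix.cons_val_fin_one, mul_zero, add_zero]
      using hentry (hR'2 n) 0 1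
  have l4 : ∀ n, R' n 0 0 = 0 := fun n => by
    have : Tendsto (fun _ : ℂ => (0 : ℂ)) (𝓝[≠] (conj (lam n))) (𝓝 (R' n 0 0)) := by
      simpa [Matrix.mul_apply, Fin.sum_univ_two] using hentry (hR'2 n) 0 0
    exact tendsto_nhds_unique this tendsto_const_nhds
  have hd : ∀ i j, DifferentiableOn ℂ (fun z => M z i j) (↑(poleSet lam))ᶜ := fun i j => by
    rw [coe_compl_poleSet]; exact h.analytic i j
  have hf : ∀ z ∉ poleSet lam, M z 0 0 = 1 + partialFrac lam (fun n => R n 0 0) z := fun z hz => by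
    refine eq_partialFrac hlam (F := fun z => M z 0 0) (poleSet lam) (fun n => by simp [poleSet])
      (hd 0 0) u1 ?_ ?_ hz
    · intro q hq hq'
      simp only [poleSet, Finset.mem_union, Finset.mem_image, Finset.mem_univ, true_and] at hq
      rcases hq with ⟨n, rfl⟩ | ⟨n, rfl⟩
      · exact absurd rfl (hq' n)
      · simpa [l4 n] using l1 n
    · simpa using tendsto_zero_of_isBigO_inv (h.normalization 0 0)
  have hg : ∀ z ∉ poleSet lam,
      M z 0 1 = 0 + partialFrac (fun n => conj (lam n)) (fun n => R' n 0 1) z := fun z hz => by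
    refine eq_partialFrac hinj' (F := fun z => M z 0 1) (poleSet lam)
      (fun n => by simp [poleSet]) (hd 0 1) l2 ?_ ?_ hz
    · intro q hq hq'
      simp only [poleSet, Finset.mem_union, Finset.mem_image, Finset.mem_univ, true_and] at hq
      rcases hq with ⟨n, rfl⟩ | ⟨n, rfl⟩
      · simpa [u4 n] using u2 n
      · exact absurd rfl (hq' n)
    · simpa using tendsto_zero_of_isBigO_inv (h.normalization 0 1)
  have hev : ∀ p, ∀ᶠ z in 𝓝[≠] p, z ∉ poleSet lam := fun p => by
    have hfin : ((poleSet lam : Set ℂ) \ {p}).Finite := (poleSet lam).finite_toSet.sdiff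
    have : ((poleSet lam : Set ℂ) \ {p})ᶜ ∈ 𝓝 p := hfin.isClosed.isOpen_compl.mem_nhds (by simp)
    filter_upwards [nhdsWithin_le_nhds this, self_mem_nhdsWithin] with w h1 h2 h3
    exact h1 ⟨h3, h2⟩
  refine ⟨fun n => R n 0 0, fun n => R' n 0 1, ⟨fun n => ?_, fun n => ?_⟩, ?_⟩
  · have h1 : Tendsto (partialFrac (fun m => conj (lam m)) fun n => R' n 0 1) (𝓝[≠] (lam n)) (𝓝 _) :=
      (partialFrac_differentiableAt _
        fun m => ne_conj him n m).continuousAt.tendsto.mono_left nhdsWithin_le_nhds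
    refine tendsto_nhds_unique (u3 n) ((h1.const_mul (γ n)).congr' ?_)
    filter_upwards [hev (lam n)] with z hz
    rw [hg z hz]; ring
  · have h1 : Tendsto (partialFrac lam fun n => R n 0 0) (𝓝[≠] (conj (lam n))) (𝓝 _) :=
      (partialFrac_differentiableAt _
        fun m => hne n m).continuousAt.tendsto.mono_left nhdsWithin_le_nhds
    refine tendsto_nhds_unique (l3 n) (((h1.const_add 1).const_mul (-conj (γ n))).congr' ?_)
    filter_upwards [hev (conj (lam n))] with z hz
    rw [hf z hz]; ring
  · have h1 := partialFrac_tendsto_mul (fun n => conj (lam n)) fun n => R' n 0 1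
    have h2 := tendsto_nhds_unique (tendsto_cobounded_of_soliton_expansion hs) (h1.congr' ?_)
    · rw [← h2, mul_div_cancel₀ _ (by simp)]
    · have : ∀ᶠ z in cobounded ℂ, z ∉ poleSet lam := by
        rw [Metric.cobounded_eq_cocompact]
        exact (poleSet lam).finite_toSet.isCompact.compl_mem_cocompact
      filter_upwards [this] with z hz
      rw [hg z hz]; ring

theorem tendsto_matrix_two {l : Filter ℂ} {F : ℂ → Matrix (Fin 2) (Fin 2) ℂ}
    {R : Matrix (Fin 2) (Fin 2) ℂ} (h : ∀ i j, Tendsto (fun z => F z i j) l (𝓝 (R i j))) :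
    Tendsto F l (𝓝 R) :=
  tendsto_pi_nhds.mpr fun i => tendsto_pi_nhds.mpr fun j => h i j

/-- A solution of the residue system gives a solution of the Riemann-Hilbert problem. -/
theorem SolvesResidueSystem.exists_isRHPSolution (hlam : Function.Injective lam)
    (him : ∀ n, 0 < (lam n).im) {c : Fin N → ℂ} {x t : ℝ} {a b : Fin N → ℂ}
    (h : SolvesResidueSystem lam (evolvedConst lam c x t) 1 a b) :
    ∃ M, IsRHPSolution lam c x t M ∧
      (fun z => M z 0 1 - (2 * Complex.I * ∑ n, b n) / (2 * Complex.I * z)) =O[cobounded ℂ]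
        fun z => (z ^ 2)⁻¹ := by
  have hinj' := injective_conj_comp hlam
  have hne : ∀ n m, conj (lam n) ≠ lam m := fun n m => (ne_conj him m n).symm
  set γ := evolvedConst lam c x t with hγ
  set f : ℂ → ℂ := fun z => 1 + partialFrac lam a z with hf
  -- The second row is $(-g^*,f^*)$, dictated by the conjugation symmetry of the problem; its
  -- residue conditions are the conjugates of those for the first row.
  set fs : ℂ → ℂ := fun z =>
    1 + partialFrac (fun m => conj (lam m)) (fun m => conj (a m)) z with hfs
  set g : ℂ → ℂ := partialFrac (fun m => conj (lam m)) b with hg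
  set gs : ℂ → ℂ := partialFrac lam (fun m => -conj (b m)) with hgs
  have hlin : ∀ q : ℂ, Tendsto (fun z : ℂ => (z - q)) (𝓝[≠] q) (𝓝 0) := fun q => by
    have : ContinuousAt (fun z : ℂ => (z - q)) q := by fun_prop
    simpa using this.tendsto.mono_left nhdsWithin_le_nhds
  have ha : ∀ n, conj (a n) = -conj (γ n) * gs (conj (lam n)) := fun n => by
    rw [h.upper n, map_mul, conj_partialFrac]
    simp [hgs, partialFrac, neg_div]
  have hb : ∀ n, -conj (b n) = γ n * fs (lam n) := fun n => by
    rw [h.lower n, map_mul, map_add, conj_partialFrac]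
    simp [hfs]
  have cfs : ∀ n, Tendsto fs (𝓝[≠] (lam n)) (𝓝 (fs (lam n))) := fun n =>
    ((partialFrac_differentiableAt _ fun m => ne_conj him n m).const_add
      _).continuousAt.tendsto.mono_left nhdsWithin_le_nhds
  have cg : ∀ n, Tendsto g (𝓝[≠] (lam n)) (𝓝 (g (lam n))) := fun n =>
    (partialFrac_differentiableAt _
      fun m => ne_conj him n m).continuousAt.tendsto.mono_left nhdsWithin_le_nhds
  have cf : ∀ n, Tendsto f (𝓝[≠] (conj (lam n))) (𝓝 (f (conj (lam n)))) := fun n =>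
    ((partialFrac_differentiableAt _ fun m => hne n m).const_add
      _).continuousAt.tendsto.mono_left nhdsWithin_le_nhds
  have cgs : ∀ n, Tendsto gs (𝓝[≠] (conj (lam n))) (𝓝 (gs (conj (lam n)))) := fun n =>
    (partialFrac_differentiableAt _
      fun m => hne n m).continuousAt.tendsto.mono_left nhdsWithin_le_nhds
  have rf : ∀ n, Tendsto (fun z => (z - lam n) * f z) (𝓝[≠] (lam n)) (𝓝 (a n)) := fun n => by
    have := (hlin (lam n)).add (partialFrac_residue hlam a n)
    rw [zero_add] at this
    exact this.congr fun z => by simp only [hf]; ring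
  have rfs : ∀ n, Tendsto (fun z => (z - conj (lam n)) * fs z) (𝓝[≠] (conj (lam n)))
      (𝓝 (conj (a n))) := fun n => by
    have := (hlin (conj (lam n))).add (partialFrac_residue hinj' (fun m => conj (a m)) n)
    rw [zero_add] at this
    exact this.congr fun z => by simp only [hfs]; ring
  have rg := partialFrac_residue hinj' b
  have rgs := partialFrac_residue hlam fun m => -conj (b m)
  refine ⟨fun z => !![f z, g z; gs z, fs z], ⟨?_, fun n => ?_, fun n => ?_, ?_⟩, ?_⟩
  · intro i j w hw
    have h1 := (partialFrac_differentiableAt a fun n => (hw n).1).const_add 1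
    have h2 := (partialFrac_differentiableAt (fun m => conj (a m)) fun n => (hw n).2).const_add 1
    have h3 := partialFrac_differentiableAt b fun n => (hw n).2
    have h4 := partialFrac_differentiableAt (fun m => -conj (b m)) fun n => (hw n).1
    fin_cases i <;> fin_cases j
    exacts [h1.differentiableWithinAt, h3.differentiableWithinAt, h4.differentiableWithinAt,
      h2.differentiableWithinAt]
  · refine ⟨!![a n, 0; -conj (b n), 0], tendsto_matrix_two fun i j => ?_,
      tendsto_matrix_two fun i j => ?_⟩
    · fin_cases i <;> fin_cases j
      · simpa using rf n
      · simpa using (hlin (lam n)).mul (cg n)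
      · simpa using rgs n
      · simpa using (hlin (lam n)).mul (cfs n)
    · change Tendsto (fun z => (!![f z, g z; gs z, fs z] * !![0, 0; γ n, 0]) i j) _ _
      fin_cases i <;> fin_cases j
      · simpa [Matrix.mul_apply, Fin.sum_univ_two, h.upper n, mul_comm] using
          (cg n).mul_const (γ n)
      · simp [Matrix.mul_apply, Fin.sum_univ_two]
      · simpa [Matrix.mul_apply, Fin.sum_univ_two, hb n, mul_comm] using (cfs n).mul_const (γ n)
      · simp [Matrix.mul_apply, Fin.sum_univ_two]
  · rw [neg_conj_evolvedConst]
    refine ⟨!![0, b n; 0, conj (a n)], tendsto_matrix_two fun i j => ?_,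
      tendsto_matrix_two fun i j => ?_⟩
    · fin_cases i <;> fin_cases j
      · simpa using (hlin (conj (lam n))).mul (cf n)
      · simpa using rg n
      · simpa using (hlin (conj (lam n))).mul (cgs n)
      · simpa using rfs n
    · change Tendsto (fun z => (!![f z, g z; gs z, fs z] * !![0, -conj (γ n); 0, 0]) i j) _ _
      fin_cases i <;> fin_cases j
      · simp [Matrix.mul_apply, Fin.sum_univ_two]
      · have := (cf n).mul_const (-conj (γ n))
        rw [show f (conj (lam n)) * -conj (γ n) = b n by rw [h.lower n]; ring] at this
        simpa [Matrix.mul_apply, Fin.sum_univ_two] using this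
      · simp [Matrix.mul_apply, Fin.sum_univ_two]
      · have := (cgs n).mul_const (-conj (γ n))
        rw [show gs (conj (lam n)) * -conj (γ n) = conj (a n) by rw [ha n]; ring] at this
        simpa [Matrix.mul_apply, Fin.sum_univ_two] using this
  · have hO := fun p a : Fin N → ℂ => isBigO_inv_of_tendsto_mul (partialFrac_tendsto_mul p a)
    intro i j
    fin_cases i <;> fin_cases j
    · simpa [hf] using hO lam a
    · simpa using hO (fun m => conj (lam m)) b
    · simpa using hO lam fun m => -conj (b m)
    · simpa [hfs] using hO (fun m => conj (lam m)) fun m => conj (a m)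
  · refine (partialFrac_sub_isBigO (fun m => conj (lam m)) b).congr_left fun z => ?_
    rw [mul_div_mul_left _ _ (by simp)]
    simp [hg]

end RHP

/-! ### Blaschke-type products -/

/-- The product `∏ (z - q_n) / (z - p_n)`. -/
noncomputable def ratioProd {ι : Type*} (s : Finset ι) (p q : ι → ℂ) (z : ℂ) : ℂ :=
  ∏ n ∈ s, (z - q n) / (z - p n)

section RatioProd
variable {ι : Type*}

theorem ratioProd_differentiableAt {s : Finset ι} {p : ι → ℂ} (q : ι → ℂ) {z : ℂ}
    (h : ∀ n ∈ s, z ≠ p n) : DifferentiableAt ℂ (ratioProd s p q) z := by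
  unfold ratioProd
  refine DifferentiableAt.fun_finsetProd fun n hn => ?_
  exact DifferentiableAt.div (by fun_prop) (by fun_prop) (sub_ne_zero.mpr (h n hn))

/-- The two limits are proved together because the induction uses $z(PQ-1)=z(P-1)\,Q+z(Q-1)$, which
needs $Q\to1$ as well. -/
theorem ratioProd_tendsto_mul_sub_one (s : Finset ι) (p q : ι → ℂ) :
    Tendsto (ratioProd s p q) (cobounded ℂ) (𝓝 1) ∧
    Tendsto (fun z => z * (ratioProd s p q z - 1)) (cobounded ℂ) (𝓝 (∑ n ∈ s, (p n - q n))) := by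
  classical
  induction s using Finset.induction_on with
  | empty =>
    rw [show ratioProd ∅ p q = fun _ => 1 from funext fun z => by simp [ratioProd]]
    simp
  | insert m s hm ih =>
    have h1 : Tendsto (fun z => z * ((z - q m) / (z - p m) - 1)) (cobounded ℂ)
        (𝓝 (p m - q m)) := by
      refine (tendsto_div_sub_cobounded (p m - q m) (p m)).congr' ?_
      have : ∀ᶠ w in cobounded ℂ, w ≠ p m := by
        rw [Metric.cobounded_eq_cocompact]
        exact (isCompact_singleton (x := p m)).compl_mem_cocompact
      filter_upwards [this] with z hz
      have := sub_ne_zero.mpr hz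
      field_simp
      ring
    have h2 : Tendsto (fun z => z * (ratioProd (insert m s) p q z - 1)) (cobounded ℂ)
        (𝓝 (∑ n ∈ insert m s, (p n - q n))) := by
      have := (h1.mul ih.1).add ih.2
      rw [mul_one, ← Finset.sum_insert (f := fun n => p n - q n) hm] at this
      refine this.congr fun z => ?_
      rw [ratioProd, ratioProd, Finset.prod_insert hm]; ring
    refine ⟨?_, h2⟩
    have := (tendsto_zero_of_isBigO_inv (isBigO_inv_of_tendsto_mul h2)).add_const 1
    simpa using this

theorem ratioProd_ofReal_norm (s : Finset ι) {p : ι → ℂ} {x : ℝ} (h : ∀ n ∈ s, (x : ℂ) ≠ p n) :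
    ‖ratioProd s p (fun n => conj (p n)) x‖ = 1 := by
  rw [ratioProd, norm_prod]
  refine Finset.prod_eq_one fun n hn => ?_
  rw [norm_div, show (x : ℂ) - conj (p n) = conj ((x : ℂ) - p n) by simp, RCLike.norm_conj]
  exact div_self (norm_ne_zero_iff.mpr (sub_ne_zero.mpr (h n hn)))

end RatioProd

/-! ### The amplitude bound by Phragmén–Lindelöf -/

/-- A function which is analytic on the closed lower half plane, bounded by one on the real line
and of the form `1 + l / z + o(1 / z)` at infinity satisfies `Im l ≥ 0`. -/
theorem im_nonneg_of_norm_le_one {h : ℂ → ℂ} {l : ℂ}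
    (hd : ∀ z : ℂ, z.im ≤ 0 → DifferentiableAt ℂ h z) (hb : ∀ x : ℝ, ‖h x‖ ≤ 1)
    (hl : Tendsto (fun z => z * (h z - 1)) (cobounded ℂ) (𝓝 l)) : 0 ≤ l.im := by
  have h1 : Tendsto h (cobounded ℂ) (𝓝 1) := by
    simpa using (tendsto_zero_of_isBigO_inv (isBigO_inv_of_tendsto_mul hl)).add_const 1
  -- The rotation $w\mapsto -iw$ carries the right half plane to the lower one, its imaginary axis
  -- to the real line, and the positive axis to the ray $z=-iy$.
  have hI : Tendsto (fun w : ℂ => -Complex.I * w) (cobounded ℂ) (cobounded ℂ) :=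
    tendsto_mul_left_cobounded (by simp)
  have hR : Tendsto (fun x : ℝ => (x : ℂ)) atTop (cobounded ℂ) := by
    rw [← tendsto_norm_atTop_iff_cobounded]
    simpa using tendsto_abs_atTop_atTop
  have hk := h1.comp hI
  have key : ∀ y : ℝ, 0 ≤ y → ‖h (-Complex.I * y)‖ ≤ 1 := fun y hy => by
    refine PhragmenLindelof.right_half_plane_of_bounded_on_real
      (f := fun w => h (-Complex.I * w)) (z := y) ?_ ?_ ?_ ?_ (by simpa using hy)
    · refine DifferentiableOn.diffContOnCl fun w hw => ?_
      rw [Complex.closure_setOfPred_lt_re] at hw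
      have hw' : 0 ≤ w.re := hw
      refine DifferentiableAt.differentiableWithinAt ?_
      exact (hd _ (by simpa using hw')).comp w (by fun_prop)
    -- The zero constants reduce the growth condition to boundedness near infinity, which holds
    -- since $h\to1$.
    · refine ⟨0, by norm_num, 0, ?_⟩
      simpa using (hk.isBigO_one ℝ).mono inf_le_left
    · exact (hk.comp hR).norm.isBoundedUnder_le
    · intro x
      have : -Complex.I * (x * Complex.I) = ((x : ℝ) : ℂ) := by
        linear_combination (-(x : ℂ)) * Complex.I_mul_I
      rw [this]
      exact hb x
  have h3 := ((hl.comp hI).comp hR).const_mul Complex.I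
  have h4 := (Complex.continuous_re.tendsto _).comp h3
  have h5 : (Complex.I * l).re ≤ 0 := by
    refine le_of_tendsto h4 ?_
    filter_upwards [eventually_ge_atTop 0] with y hy
    have h6 := (Complex.re_le_norm _).trans (key y hy)
    simp only [Function.comp_apply]
    have h7 : Complex.I * (-Complex.I * (y : ℂ) * (h (-Complex.I * y) - 1)) =
        y * (h (-Complex.I * y) - 1) := by
      linear_combination (-(y : ℂ) * (h (-Complex.I * y) - 1)) * Complex.I_mul_I
    rw [h7, Complex.re_ofReal_mul]
    simp only [Complex.sub_re, Complex.one_re]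
    nlinarith
  simpa using h5

/-- The cross terms in $|f+gu|^2+|\bar fu-\bar g|^2$ cancel, so this equals $2(|f|^2+|g|^2)=2$; two
nonnegative numbers whose squares add up to $2$ have sum at most $2$. -/
theorem norm_half_sum_le_one {f g u : ℂ} (hfg : ‖f‖ ^ 2 + ‖g‖ ^ 2 = 1) (hu : ‖u‖ = 1) :
    ‖(f + conj f * u + g * u - conj g) / 2‖ ≤ 1 := by
  have e1 : ‖f + g * u‖ ^ 2 + ‖conj f * u - conj g‖ ^ 2 = 2 := by
    have hu2 : ‖u‖ ^ 2 = 1 := by rw [hu]; norm_num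
    rw [← Complex.normSq_eq_norm_sq, Complex.normSq_apply] at *
    rw [← Complex.normSq_eq_norm_sq, Complex.normSq_apply] at *
    simp only [Complex.add_re, Complex.add_im, Complex.sub_re, Complex.sub_im, Complex.mul_re,
      Complex.mul_im, Complex.conj_re, Complex.conj_im]
    linear_combination (f.re ^ 2 + f.im ^ 2 + g.re ^ 2 + g.im ^ 2) * hu2 + 2 * hfg
  have e2 := norm_add_le (f + g * u) (conj f * u - conj g)
  rw [show f + g * u + (conj f * u - conj g) = f + conj f * u + g * u - conj g by ring] at e2
  rw [norm_div, Complex.norm_ofNat, div_le_one (by norm_num)]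
  nlinarith [sq_nonneg (‖f + g * u‖ - ‖conj f * u - conj g‖), norm_nonneg (f + g * u),
    norm_nonneg (conj f * u - conj g)]

section Bound
variable {N : ℕ} {lam γ : Fin N → ℂ} {a b : Fin N → ℂ}

set_option maxHeartbeats 400000 in
/-- The amplitude bound, in terms of the residues of `M₁₂`. -/
theorem SolvesResidueSystem.norm_sum_le (hlam : Function.Injective lam)
    (him : ∀ n, 0 < (lam n).im) (h : SolvesResidueSystem lam γ 1 a b) :
    ‖∑ n, b n‖ ≤ (∑ n, lam n).im := by
  -- With this phase both $\omega\sum b_n$ and $-\overline{\omega\sum b_n}$ equal $-i|\sum b_n|$, so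
  -- the two terms of `H` containing $b$ reinforce each other.
  obtain ⟨ω, hω, hωb⟩ : ∃ ω : ℂ, ‖ω‖ = 1 ∧ ω * ∑ n, b n = -Complex.I * ‖∑ n, b n‖ := by
    by_cases h0 : ∑ n, b n = 0
    · exact ⟨1, by simp, by simp [h0]⟩
    · refine ⟨-Complex.I * ‖∑ n, b n‖ / ∑ n, b n, ?_, div_mul_cancel₀ _ h0⟩
      simp [div_self (norm_ne_zero_iff.mpr h0)]
  set B : ℂ → ℂ := ratioProd Finset.univ lam fun n => conj (lam n) with hB
  -- This is $B(z)/(z-\overline{\lambda_n})$ with the common factor already cancelled, so that `H`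
  -- is differentiable at $\overline{\lambda_n}$ itself.
  set E : Fin N → ℂ → ℂ := fun n z => 1 / (z - lam n) *
    ratioProd (Finset.univ.erase n) lam (fun n => conj (lam n)) z with hE
  have hEB : ∀ (x : ℝ) n, E n x = 1 / ((x : ℂ) - conj (lam n)) * B x := fun x n => by
    have h1 := sub_ne_zero.mpr (ofReal_ne him x n).1
    have h2 := sub_ne_zero.mpr (ofReal_ne him x n).2
    simp only [hE, hB, ratioProd]
    rw [← Finset.mul_prod_erase _ _ (Finset.mem_univ n)]
    field_simp
  set H : ℂ → ℂ := fun z => (1 + partialFrac lam a z + B z +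
    (∑ n, (conj (a n) + ω * b n) * E n z) - partialFrac lam (fun n => conj (ω * b n)) z) / 2 with hH
  have hbd : ∀ x : ℝ, ‖H x‖ ≤ 1 := fun x => by
    have h1 := h.norm_sq_eq hlam him x
    set f := 1 + partialFrac lam a x with hf
    set g := ω * partialFrac (fun m => conj (lam m)) b x with hg
    have h2 : ‖f‖ ^ 2 + ‖g‖ ^ 2 = 1 := by
      rw [hg, norm_mul, hω, one_mul, h1]; simp
    have h3 := norm_half_sum_le_one h2
      (ratioProd_ofReal_norm Finset.univ fun n _ => (ofReal_ne him x n).1)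
    convert h3 using 3
    have h4 : conj f = 1 + partialFrac (fun n => conj (lam n)) (fun n => conj (a n)) x := by
      rw [hf, map_add, conj_partialFrac]; simp
    have h5 : conj g = partialFrac lam (fun n => conj (ω * b n)) x := by
      rw [hg, map_mul, conj_partialFrac]
      simp [partialFrac, Finset.mul_sum, mul_div_assoc]
    have h6 : ∑ n, (conj (a n) + ω * b n) * E n x =
        partialFrac (fun n => conj (lam n)) (fun n => conj (a n)) x * B x + g * B x := by
      rw [hg, ← add_mul]
      simp only [partialFrac, Finset.mul_sum, ← Finset.sum_add_distrib, Finset.sum_mul]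
      refine Finset.sum_congr rfl fun n _ => ?_
      rw [hEB]; ring
    rw [h5, h4, h6]
    ring
  have hdiff : ∀ z : ℂ, z.im ≤ 0 → DifferentiableAt ℂ H z := fun z hz => by
    have hne := ne_of_im_nonpos him hz
    have d1 := partialFrac_differentiableAt a hne
    have d2 : DifferentiableAt ℂ B z := ratioProd_differentiableAt _ fun n _ => hne n
    have d3 : DifferentiableAt ℂ (fun z => ∑ n, (conj (a n) + ω * b n) * E n z) z :=
      DifferentiableAt.fun_sum fun n _ =>
        (((differentiableAt_const (1 : ℂ)).div (by fun_prop : DifferentiableAt ℂ (· - lam n) z)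
          (sub_ne_zero.mpr (hne n))).mul
            (ratioProd_differentiableAt _ fun m _ => hne m)).const_mul _
    have d4 := partialFrac_differentiableAt (fun n => conj (ω * b n)) hne
    exact ((((d1.const_add 1).add d2).add d3).sub d4).div_const 2
  -- The sums over $a_n$ and $\overline{a_n}$ combine to a real number, so only the terms from `B`
  -- and from $b$ contribute to the imaginary part.
  have hlim := im_nonneg_of_norm_le_one (l := (∑ n, a n + ∑ n, (lam n - conj (lam n)) +
    ∑ n, (conj (a n) + ω * b n) * (1 * 1) - ∑ n, conj (ω * b n)) / 2) hdiff hbd ?_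
  · have e1 : ∑ n, (lam n - conj (lam n)) = 2 * Complex.I * ((∑ n, lam n).im : ℝ) := by
      rw [Finset.sum_sub_distrib, ← map_sum, Complex.sub_conj]
      push_cast; ring
    have e2 : ∑ n, (conj (a n) + ω * b n) * (1 * 1) =
        conj (∑ n, a n) + -Complex.I * ‖∑ n, b n‖ := by
      simp only [mul_one, Finset.sum_add_distrib, ← Finset.mul_sum, hωb, map_sum]
    have e3 : ∑ n, conj (ω * b n) = Complex.I * ‖∑ n, b n‖ := by
      rw [← map_sum, ← Finset.mul_sum, hωb]; simp
    rw [e1, e2, e3] at hlim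
    have e4 : ((∑ n, a n + 2 * Complex.I * ((∑ n, lam n).im : ℝ) +
        (conj (∑ n, a n) + -Complex.I * ‖∑ n, b n‖) - Complex.I * ‖∑ n, b n‖) / 2).im =
        (∑ n, lam n).im - ‖∑ n, b n‖ := by
      rw [show (∑ n, a n + 2 * Complex.I * ((∑ n, lam n).im : ℝ) +
        (conj (∑ n, a n) + -Complex.I * ‖∑ n, b n‖) - Complex.I * ‖∑ n, b n‖) / 2 =
        ((∑ n, a n) + conj (∑ n, a n)) / 2 +
          (((∑ n, lam n).im - ‖∑ n, b n‖ : ℝ) : ℂ) * Complex.I by push_cast; ring]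
      rw [Complex.add_conj]
      simp
    linarith
  · have hErr : ∀ n, Tendsto (fun z => (conj (a n) + ω * b n) *
        (z * (1 / (z - lam n)) * ratioProd (Finset.univ.erase n) lam (fun n => conj (lam n)) z))
        (cobounded ℂ) (𝓝 ((conj (a n) + ω * b n) * (1 * 1))) := fun n =>
      ((tendsto_div_sub_cobounded 1 (lam n)).mul
        (ratioProd_tendsto_mul_sub_one _ _ _).1).const_mul _
    have t := ((((partialFrac_tendsto_mul lam a).add
      (ratioProd_tendsto_mul_sub_one Finset.univ lam fun n => conj (lam n)).2).add
      (tendsto_finsetSum Finset.univ fun n _ => hErr n)).sub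
      (partialFrac_tendsto_mul lam fun n => conj (ω * b n))).div_const 2
    refine t.congr fun z => ?_
    have : z * ∑ n, (conj (a n) + ω * b n) * E n z = ∑ n, (conj (a n) + ω * b n) *
        (z * (1 / (z - lam n)) *
          ratioProd (Finset.univ.erase n) lam (fun n => conj (lam n)) z) := by
      rw [Finset.mul_sum]
      refine Finset.sum_congr rfl fun n _ => ?_
      simp only [hE]; ring
    rw [← this]
    simp only [hH, hB]
    ring

end Bound

/-! ### The extremal constants -/

section Extremal
variable {N : ℕ}

/-- If `a n` is the residue at `p n` of the product of `∏ (z - q n) / (z - p n)` and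
`e + ∑ b n / (z - q n)`, then that product is `e + ∑ a n / (z - p n)`. -/
theorem partialFrac_eq_mul_ratioProd {p q a b : Fin N → ℂ} {e : ℂ} (hp : Function.Injective p)
    (hq : Function.Injective q) (hpq : ∀ n m, p n ≠ q m)
    (h : ∀ n, a n = ((p n - q n) * ratioProd (Finset.univ.erase n) p q (p n)) *
      (e + partialFrac q b (p n)))
    {z : ℂ} (hz : ∀ n, z ≠ p n ∧ z ≠ q n) :
    (e + partialFrac q b z) * ratioProd Finset.univ p q z = e + partialFrac p a z := by
  classical
  have hcg : ∀ {w : ℂ}, (∀ n, w ≠ q n) → ContinuousAt (fun z => e + partialFrac q b z) w :=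
    fun hw => ((partialFrac_differentiableAt b hw).const_add e).continuousAt
  refine eq_partialFrac hp (F := fun z => (e + partialFrac q b z) * ratioProd Finset.univ p q z)
    (Finset.univ.image p ∪ Finset.univ.image q) (fun n => by simp) ?_ ?_ ?_ ?_ ?_
  · intro w hw
    simp only [Finset.coe_union, Finset.coe_image, Finset.coe_univ, Set.image_univ,
      Set.mem_compl_iff, Set.mem_union, Set.mem_range, not_or, not_exists] at hw
    exact (((partialFrac_differentiableAt b fun n hn => hw.2 n hn.symm).const_add e).mul
      (ratioProd_differentiableAt q fun n _ hn => hw.1 n hn.symm)).differentiableWithinAt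
  · intro n
    have hc : ContinuousAt (fun z => ((z - q n) * ratioProd (Finset.univ.erase n) p q z) *
        (e + partialFrac q b z)) (p n) :=
      ((by fun_prop : ContinuousAt (fun z => z - q n) (p n)).mul
        (ratioProd_differentiableAt q fun m hm hnm =>
          Finset.ne_of_mem_erase hm (hp hnm).symm).continuousAt).mul (hcg fun m => hpq n m)
    have ht := hc.tendsto.mono_left (nhdsWithin_le_nhds (s := {p n}ᶜ))
    simp only [← h n] at ht
    refine ht.congr' ?_
    filter_upwards [self_mem_nhdsWithin] with w hw
    have hw' : w - p n ≠ 0 := sub_ne_zero.mpr hw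
    rw [ratioProd, ratioProd, ← Finset.mul_prod_erase _ _ (Finset.mem_univ n)]
    field_simp
  · intro w hw hwp
    simp only [Finset.mem_union, Finset.mem_image, Finset.mem_univ, true_and] at hw
    rcases hw with ⟨n, rfl⟩ | ⟨n, rfl⟩
    · exact absurd rfl (hwp n)
    · have h1 := partialFrac_residue hq b n
      have h2 : Tendsto (fun z => (z - q n) * e) (𝓝[≠] (q n)) (𝓝 0) := by
        have : ContinuousAt (fun z : ℂ => (z - q n) * e) (q n) := by fun_prop
        simpa using this.tendsto.mono_left nhdsWithin_le_nhds
      have h3 : Tendsto (ratioProd Finset.univ p q) (𝓝[≠] (q n)) (𝓝 0) := by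
        have := (ratioProd_differentiableAt q (s := Finset.univ) (z := q n)
          fun m _ => (hpq m n).symm).continuousAt.tendsto.mono_left
            (nhdsWithin_le_nhds (s := {q n}ᶜ))
        rwa [ratioProd, Finset.prod_eq_zero (Finset.mem_univ n) (by simp)] at this
      have := (h2.add h1).mul h3
      rw [mul_zero] at this
      exact this.congr fun w => by ring
  · have := (((partialFrac_tendsto_zero q b).const_add e).mul
      (ratioProd_tendsto_mul_sub_one Finset.univ p q).1).sub_const e
    simpa using this
  · simp only [Finset.mem_union, Finset.mem_image, Finset.mem_univ, true_and, not_or, not_exists]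
    exact ⟨fun n hn => (hz n).1 hn.symm, fun n hn => (hz n).2 hn.symm⟩

variable {lam : Fin N → ℂ}

/-- The right-hand side is the residue at $\lambda_n$ of
$B=\prod(z-\overline{\lambda_m})/(z-\lambda_m)$; this is the property that singles out these
constants. -/
theorem extremalConst_eq_ratioProd (lam : Fin N → ℂ) (n : Fin N) :
    extremalConst lam n = (lam n - conj (lam n)) *
      ratioProd (Finset.univ.erase n) lam (fun m => conj (lam m)) (lam n) := by
  rw [extremalConst, ratioProd, ← Finset.mul_prod_erase _ _ (Finset.mem_univ n), mul_assoc,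
    ← Finset.prod_mul_distrib]
  simp only [div_eq_mul_inv]

theorem extremalConst_ne_zero (hlam : Function.Injective lam) (him : ∀ n, 0 < (lam n).im)
    (n : Fin N) : extremalConst lam n ≠ 0 := by
  refine mul_ne_zero (Finset.prod_ne_zero_iff.mpr fun l _ => sub_ne_zero.mpr (ne_conj him n l))
    (Finset.prod_ne_zero_iff.mpr fun l hl => inv_ne_zero (sub_ne_zero.mpr fun h => ?_))
  exact Finset.ne_of_mem_erase hl (hlam h).symm

theorem SolvesResidueSystem.sum_eq_of_extremalConst (hlam : Function.Injective lam)
    (him : ∀ n, 0 < (lam n).im) {a b : Fin N → ℂ}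
    (h : SolvesResidueSystem lam (extremalConst lam) 1 a b) :
    ∑ n, b n = Complex.I * ((∑ n, lam n).im : ℝ) := by
  have hinj' := injective_conj_comp hlam
  set g := partialFrac (fun m => conj (lam m)) b with hg
  set B := ratioProd Finset.univ lam fun m => conj (lam m) with hB
  have h1 : ∀ z ∉ poleSet lam, g z * B z = partialFrac lam a z := fun z hz => by
    have := partialFrac_eq_mul_ratioProd (e := 0) (a := a) (b := b) hlam hinj' (ne_conj him)
      (fun n => by rw [← extremalConst_eq_ratioProd, zero_add]; exact h.upper n)
      (notMem_poleSet.mp hz)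
    simpa using this
  -- This is $f/B=1-g$: the residue of $1/B$ at $\overline{\lambda_n}$ is $\overline{c_n}$, so that
  -- of $f/B$ is $\overline{c_n}f(\overline{\lambda_n})=-b_n$.
  have h2 : ∀ z ∉ poleSet lam, (1 + partialFrac lam a z) *
      ratioProd Finset.univ (fun m => conj (lam m)) lam z = 1 - g z := fun z hz => by
    have := partialFrac_eq_mul_ratioProd (e := 1) (a := fun n => -b n) (b := a) hinj' hlam
      (fun n m => (ne_conj him m n).symm)
      (fun n => by
        have hc : conj (extremalConst lam n) = (conj (lam n) - lam n) *
            ratioProd (Finset.univ.erase n) (fun m => conj (lam m)) lam (conj (lam n)) := by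
          rw [extremalConst_eq_ratioProd]
          simp [ratioProd, map_prod]
        rw [← hc, h.lower n]; ring)
      (fun n => (notMem_poleSet.mp hz n).symm)
    rw [this, hg]
    simp [partialFrac, neg_div, sub_eq_add_neg]
  -- Eliminating $f$ between $f=1+gB$ and $f=(1-g)B$.
  have h3 : ∀ z ∉ poleSet lam, 2 * (g z * B z) = B z - 1 := fun z hz => by
    have hBB : B z * ratioProd Finset.univ (fun m => conj (lam m)) lam z = 1 := by
      rw [hB, ratioProd, ratioProd, ← Finset.prod_mul_distrib]
      refine Finset.prod_eq_one fun n _ => ?_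
      have e1 := sub_ne_zero.mpr (notMem_poleSet.mp hz n).1
      have e2 := sub_ne_zero.mpr (notMem_poleSet.mp hz n).2
      field_simp
    have e3 := h2 z hz
    rw [← h1 z hz] at e3
    linear_combination B z * e3 - (1 + g z * B z) * hBB
  have hBt := ratioProd_tendsto_mul_sub_one Finset.univ lam fun m => conj (lam m)
  have t1 := ((partialFrac_tendsto_mul (fun m => conj (lam m)) b).mul hBt.1).const_mul 2
  have t2 := tendsto_nhds_unique t1 (hBt.2.congr' ?_)
  · rw [Finset.sum_sub_distrib, ← map_sum, Complex.sub_conj] at t2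
    push_cast at t2
    linear_combination t2 / 2
  · have : ∀ᶠ z in cobounded ℂ, z ∉ poleSet lam := by
      rw [Metric.cobounded_eq_cocompact]
      exact (poleSet lam).finite_toSet.isCompact.compl_mem_cocompact
    filter_upwards [this] with z hz
    linear_combination (-z) * h3 z hz

end Extremal

/-! ### Uniqueness and extremality -/

theorem lemma2p1 {N : ℕ} (lam : Fin N → ℂ) (hlam : Function.Injective lam)
    (him : ∀ n, 0 < (lam n).im) :
    (∃! ψ : ℝ → ℝ → ℂ, IsNSoliton lam (extremalConst lam) ψ) ∧
    ∀ ψ : ℝ → ℝ → ℂ, IsNSoliton lam (extremalConst lam) ψ →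
      IsExtremalAt lam ψ 0 0 ∧ ‖ψ 0 0‖ = 2 * (∑ n, lam n).im := by
  refine ⟨?_, fun ψ hψ => ?_⟩
  · choose a b hab using fun x t =>
      exists_solvesResidueSystem hlam him (evolvedConst lam (extremalConst lam) x t) 1
    refine ⟨fun x t => 2 * Complex.I * ∑ n, b x t n,
      fun x t => (hab x t).exists_isRHPSolution hlam him, fun ψ hψ => ?_⟩
    funext x t
    obtain ⟨M, hM, hs⟩ := hψ x t
    obtain ⟨a', b', h', hψ'⟩ := hM.exists_solvesResidueSystem hlam him hs
    rw [hψ', (h'.unique hlam him (hab x t)).2]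
  · have hval : ‖ψ 0 0‖ = 2 * (∑ n, lam n).im := by
      obtain ⟨M, hM, hs⟩ := hψ 0 0
      obtain ⟨a, b, h, hψ'⟩ := hM.exists_solvesResidueSystem hlam him hs
      have hγ : evolvedConst lam (extremalConst lam) 0 0 = extremalConst lam := by
        funext n
        simp [evolvedConst, phase]
      rw [hγ] at h
      have hS : 0 ≤ (∑ n, lam n).im := by
        rw [Complex.im_sum]
        exact Finset.sum_nonneg fun n _ => (him n).le
      rw [hψ', h.sum_eq_of_extremalConst hlam him]
      simp only [norm_mul, Complex.norm_I, Complex.norm_ofNat, mul_one, one_mul,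
        Complex.norm_real, Real.norm_eq_abs, abs_of_nonneg hS]
    refine ⟨⟨⟨_, ψ, 0, 0, extremalConst_ne_zero hlam him, hψ, rfl⟩, ?_⟩, hval⟩
    rintro A ⟨c, φ, x, t, -, hφ, rfl⟩
    obtain ⟨M, hM, hs⟩ := hφ x t
    obtain ⟨a, b, h, hφ'⟩ := hM.exists_solvesResidueSystem hlam him hs
    rw [hval, hφ']
    simpa using h.norm_sum_le hlam him
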